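/- A permutation is written in one-line notation; it avoids a permutation $\pi$ if none of its subsequences is order isomorphic to $\pi$. Let $\mathbf{C}=\mathrm{Av}(312|21)$ be the juxtaposition class of all permutations (including the empty one) whose one-line notation is a concatenation $AB$ of two possibly empty words such that $A$ avoids $312$ and $B$ avoids $21$. Let $c_n$ be the number of permutations of length $n$ in $\mathbf{C}$ and let $s_{\mathbf{C}}(z)=\sum_{n\ge 0}c_n z^n\in\mathbb{Q}[[z]]$. Theorem. The series $s_{\mathbf{C}}(z)$ is algebraic over $\mathbb{Q}[z]$, and $$s_{\mathbf{C}}(z)=\frac{\bigl(1+\sqrt{1-4z}\bigr)\bigl(1-z-\sqrt{(z-1)(5z-1)}\bigr)}{4z(1-z)},$$ where each square root denotes the formal power series with constant term $1$ whose square is the given polynomial. That is, $4z(1-z)\,s_{\mathbf{C}}(z)=(1+u)(1-z-v)$ with $u^2=1-4z$, $v^2=(z-1)(5z-1)$, $u(0)=v(0)=1$. Moreover $c_0=1$, and $c_1,\dots,c_{12}$ are $1, 2, 6, 22, 88, 367, 1568, 6810, 29943, 132958, 595227, 2683373$ (the initial terms of OEIS A165538). -/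

import Mathlib

noncomputable section

namespace Juxtaposition

/-- A permutation `α` of length `k` is order isomorphic to the word `w 0, w 1, …, w (k-1)`. -/
def IsPatternOf {k n : ℕ} (α : Equiv.Perm (Fin k)) (w : Fin k → Fin n) : Prop :=
  ∀ i j, w i < w j ↔ α i < α j

/-- `σ` contains `π`: some subsequence of the one-line notation `σ 0, σ 1, …, σ (n-1)` is order
isomorphic to `π`. -/
def Contains {n k : ℕ} (σ : Equiv.Perm (Fin n)) (π : Equiv.Perm (Fin k)) : Prop :=
  ∃ f : Fin k ↪o Fin n, IsPatternOf π (fun i => σ (f i))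

/-- A set of permutations, given by its members of each length `n`. -/
abbrev PermSet : Type := (n : ℕ) → Set (Equiv.Perm (Fin n))

/-- `Av(π)`: the permutations that avoid `π`. -/
def Av {k : ℕ} (π : Equiv.Perm (Fin k)) : PermSet :=
  fun _ => {σ | ¬ Contains σ π}

/-- The juxtaposition of `U` and `V`: the permutations whose one-line notation is a concatenation
`AB`, where the (possibly empty) words `A` and `B` are order isomorphic to members of `U` and of
`V` respectively. -/
def juxtapose (U V : PermSet) : PermSet :=
  fun n => {σ | ∃ (k l : ℕ) (h : k + l = n),
    (∃ α ∈ U k, IsPatternOf α (fun i => σ (Fin.cast h (Fin.castAdd l i)))) ∧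
    (∃ β ∈ V l, IsPatternOf β (fun i => σ (Fin.cast h (Fin.natAdd k i))))}

/-- The permutation 312 (written `2, 0, 1` with values starting from zero). -/
def p312 : Equiv.Perm (Fin 3) where
  toFun := ![2, 0, 1]
  invFun := ![1, 2, 0]
  left_inv := by decide
  right_inv := by decide

/-- The permutation 21. -/
def p21 : Equiv.Perm (Fin 2) where
  toFun := ![1, 0]
  invFun := ![1, 0]
  left_inv := by decide
  right_inv := by decide

/-- The class `Av(312|21)`. -/
def classC : PermSet := juxtapose (Av p312) (Av p21)

/-- The ordinary generating function of a set of permutations, by length. -/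
def genFun (W : PermSet) : PowerSeries ℚ :=
  PowerSeries.mk fun n => ((W n).ncard : ℚ)

end Juxtaposition

end

/-! If a permutation of length `n` is cut as `AB` with `B` increasing, then `A` determines `B`: it
lists the letters missing from `A`. So pairs (permutation, valid cut) correspond to `312`-avoiding
words `A` with distinct letters below `n`. Each permutation is counted once by taking its shortest
valid `A`. A word fails to be shortest exactly when its last letter `x` can move into `B`, that is,
when every letter below `x` already occurs in `A`.

A nonempty `312`-avoiding word with last letter `x` is `L U x` with `L < x < U` and `L`, `U`
avoiding. Hence the series `W` of all words satisfies `W = 1/(1-X) + X W^2`. In the redundant words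
`L` uses every letter below `x`, so with the Catalan series `C` their series is `X C W`. The answer
is `W (1 - X C)` (`ncard_classC_add`, `genFun_classC_eq`), and solving the two quadratics gives the
square roots. -/

namespace Juxtaposition

/-! ### Structure of 312-avoiding words -/

/-- A word in the natural numbers that contains no subsequence order isomorphic to `312`. -/
def Avoids : List ℕ → Prop
  | [] => True
  | a :: l => l.Pairwise (fun b c => ¬(b < c ∧ c < a)) ∧ Avoids l

/-- A new last letter can only play the role of the `2` in `312`. -/
theorem avoids_append_singleton (l : List ℕ) (x : ℕ) :
    Avoids (l ++ [x]) ↔ Avoids l ∧ l.Pairwise (fun a b => ¬(b < x ∧ x < a)) := by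
  induction l with
  | nil => simp [Avoids]
  | cons a l ih =>
    simp only [List.cons_append, Avoids, ih, List.pairwise_append, List.pairwise_cons,
      List.mem_singleton, forall_eq, List.not_mem_nil, false_imp_iff, implies_true,
      List.Pairwise.nil, true_and]
    tauto

theorem avoids_append_of_lt {l r : List ℕ} (h : ∀ a ∈ l, ∀ b ∈ r, a < b) :
    Avoids (l ++ r) ↔ Avoids l ∧ Avoids r := by
  induction l with
  | nil => simp [Avoids]
  | cons a l ih =>
    have ih := ih fun b hb => h b (List.mem_cons_of_mem _ hb)
    have h1 : r.Pairwise (fun b c => ¬(b < c ∧ c < a)) :=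
      List.pairwise_of_forall_mem_list fun b _ c hc =>
        fun hh => (h a List.mem_cons_self c hc).not_gt hh.2
    have h2 : ∀ b ∈ l, ∀ c ∈ r, ¬(b < c ∧ c < a) := fun b _ c hc hh =>
      (h a List.mem_cons_self c hc).not_gt hh.2
    simp only [List.cons_append, Avoids, ih, List.pairwise_append]
    tauto

theorem Avoids.of_append_left {l r : List ℕ} (h : Avoids (l ++ r)) : Avoids l := by
  induction l with
  | nil => trivial
  | cons a l ih => exact ⟨(List.pairwise_append.1 h.1).1, ih h.2⟩

/-- Since no letter above `x` precedes one below `x`, the small letters form a prefix. -/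
theorem exists_append_of_pairwise {l : List ℕ} {x : ℕ} (hx : x ∉ l)
    (h : l.Pairwise (fun a b => ¬(b < x ∧ x < a))) :
    ∃ L U, l = L ++ U ∧ (∀ a ∈ L, a < x) ∧ ∀ b ∈ U, x < b := by
  induction l with
  | nil => exact ⟨[], [], by simp⟩
  | cons a l ih =>
    rw [List.pairwise_cons] at h
    rw [List.mem_cons, not_or] at hx
    rcases lt_or_gt_of_ne hx.1 with hax | hax
    · refine ⟨[], a :: l, rfl, by simp, ?_⟩
      intro b hb
      rcases List.mem_cons.1 hb with rfl | hb
      · exact hax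
      · have h1 := h.1 b hb
        have h2 : x ≠ b := fun e => hx.2 (e ▸ hb)
        lia
    · obtain ⟨L, U, rfl, hL, hU⟩ := ih hx.2 h.2
      exact ⟨a :: L, U, rfl, by simpa using ⟨hax, hL⟩, hU⟩

theorem avoids_append_singleton_iff {l : List ℕ} {x : ℕ} (hx : x ∉ l) :
    Avoids (l ++ [x]) ↔ ∃ L U, l = L ++ U ∧ (∀ a ∈ L, a < x) ∧ (∀ b ∈ U, x < b) ∧
      Avoids L ∧ Avoids U := by
  rw [avoids_append_singleton]
  constructor
  · rintro ⟨h1, h2⟩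
    obtain ⟨L, U, rfl, hL, hU⟩ := exists_append_of_pairwise hx h2
    exact ⟨L, U, rfl, hL, hU,
      (avoids_append_of_lt fun a ha b hb => (hL a ha).trans (hU b hb)).1 h1⟩
  · rintro ⟨L, U, rfl, hL, hU, h⟩
    refine ⟨(avoids_append_of_lt fun a ha b hb => (hL a ha).trans (hU b hb)).2 h, ?_⟩
    refine List.pairwise_append.2 ⟨?_, ?_, ?_⟩
    · exact List.pairwise_of_forall_mem_list fun a ha b _ hh => (hL a ha).not_gt hh.2
    · exact List.pairwise_of_forall_mem_list fun a _ b hb hh => (hU b hb).not_gt hh.1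
    · exact fun a ha b _ hh => (hL a ha).not_gt hh.2

/-! ### Enumeration of words by their last letter -/

open Classical in
/-- The `312`-avoiding words with distinct letters from the interval `[a, a + m)`. -/
noncomputable def words (a m : ℕ) : Finset (List ℕ) :=
  ((Finset.Ico a (a + m)).powerset.biUnion fun T => T.val.lists.toFinset).filter Avoids

theorem mem_words {a m : ℕ} {l : List ℕ} :
    l ∈ words a m ↔ l.Nodup ∧ (∀ y ∈ l, a ≤ y ∧ y < a + m) ∧ Avoids l := by
  simp only [words, Finset.mem_filter, Finset.mem_biUnion, Finset.mem_powerset,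
    Multiset.mem_toFinset, Multiset.mem_lists_iff, ← and_assoc]
  refine and_congr_left fun _ => ⟨?_, ?_⟩
  · rintro ⟨T, hT, h⟩
    refine ⟨?_, fun y hy => ?_⟩
    · rw [← Multiset.coe_nodup]
      change Multiset.Nodup (Quotient.mk _ l)
      exact h ▸ T.nodup
    · exact Finset.mem_Ico.1 (hT (by rw [← Finset.mem_val, h]; exact hy))
  · rintro ⟨h1, h2⟩
    exact ⟨⟨l, Multiset.coe_nodup.2 h1⟩, fun y hy => Finset.mem_Ico.2 (h2 y hy), rfl⟩

/-- The words `L U (a + i)` with `i < m`, `L ∈ P i` and `U ∈ Q i`. -/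
def glue (a m : ℕ) (P Q : ℕ → Finset (List ℕ)) : Finset (List ℕ) :=
  (Finset.range m).biUnion fun i =>
    (P i ×ˢ Q i).image fun p => p.1 ++ p.2 ++ [a + i]

theorem mem_glue {a m : ℕ} {P Q : ℕ → Finset (List ℕ)} {l : List ℕ} :
    l ∈ glue a m P Q ↔ ∃ i < m, ∃ L ∈ P i, ∃ U ∈ Q i, l = L ++ U ++ [a + i] := by
  simp only [glue, Finset.mem_biUnion, Finset.mem_range, Finset.mem_image, Finset.mem_product,
    Prod.exists]
  constructor
  · rintro ⟨i, hi, L, U, ⟨hL, hU⟩, rfl⟩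
    exact ⟨i, hi, L, hL, U, hU, rfl⟩
  · rintro ⟨i, hi, L, hL, U, hU, rfl⟩
    exact ⟨i, hi, L, U, ⟨hL, hU⟩, rfl⟩

/-- The letters below `x` recover `L`; this makes the decomposition `L U x` unique. -/
theorem append_inj_of_lt {x : ℕ} {L U L' U' : List ℕ} (hL : ∀ a ∈ L, a < x)
    (hL' : ∀ a ∈ L', a < x) (hU : ∀ a ∈ U, x < a) (hU' : ∀ a ∈ U', x < a)
    (h : L ++ U = L' ++ U') : L = L' ∧ U = U' := by
  have key : ∀ {L U : List ℕ}, (∀ a ∈ L, a < x) → (∀ a ∈ U, x < a) →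
      (L ++ U).filter (· < x) = L := by
    intro L U hL hU
    rw [List.filter_append, List.filter_eq_self.2 (by simpa using hL),
      List.filter_eq_nil_iff.2 (by simpa using fun a ha => (hU a ha).le), List.append_nil]
  have e : L = L' := by rw [← key hL hU, h, key hL' hU']
  subst e
  exact ⟨rfl, List.append_cancel_left h⟩

theorem card_glue {a m : ℕ} {P Q : ℕ → Finset (List ℕ)}
    (hP : ∀ i, ∀ L ∈ P i, ∀ y ∈ L, y < a + i) (hQ : ∀ i, ∀ U ∈ Q i, ∀ y ∈ U, a + i < y) :
    (glue a m P Q).card = ∑ i ∈ Finset.range m, (P i).card * (Q i).card := by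
  rw [glue, Finset.card_biUnion]
  · refine Finset.sum_congr rfl fun i _ => ?_
    rw [Finset.card_image_of_injOn, Finset.card_product]
    rintro ⟨L, U⟩ h ⟨L', U'⟩ h' e
    simp only [Finset.coe_product, Set.mem_prod, Finset.mem_coe] at h h'
    obtain ⟨h1, h2⟩ := append_inj_of_lt (hP i L h.1) (hP i L' h'.1) (hQ i U h.2) (hQ i U' h'.2)
      (List.append_inj_left' e rfl)
    simp [h1, h2]
  · intro i _ j _ hij
    rw [Function.onFun, Finset.disjoint_left]
    intro l h h'
    simp only [Finset.mem_image, Prod.exists] at h h'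
    obtain ⟨L, U, _, rfl⟩ := h
    obtain ⟨L', U', _, e⟩ := h'
    have := List.append_inj_right' e rfl
    simp at this
    exact hij this.symm

/-- With last letter `a + i`, there are `i` available letters below it for `L` and `m - 1 - i` above
it for `U`. -/
theorem words_eq (a m : ℕ) :
    words a m = insert [] (glue a m (words a) fun i => words (a + i + 1) (m - 1 - i)) := by
  ext l
  rw [Finset.mem_insert, mem_glue]
  rcases List.eq_nil_or_concat' l with rfl | ⟨l, x, rfl⟩
  · simp [mem_words, Avoids]
  · simp only [List.append_eq_nil_iff, List.cons_ne_nil, and_false, false_or]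
    constructor
    · intro h
      obtain ⟨h1, h2, h3⟩ := mem_words.1 h
      have hx : x ∉ l := by
        have := (List.nodup_append.1 h1).2.2
        exact fun hl => this x hl x (by simp) rfl
      obtain ⟨L, U, rfl, hL, hU, aL, aU⟩ := (avoids_append_singleton_iff hx).1 h3
      have hxm := h2 x (by simp)
      have hn := (List.nodup_append.1 (List.nodup_append.1 h1).1)
      refine ⟨x - a, by lia, L, mem_words.2 ⟨hn.1, fun y hy => ?_, aL⟩, U,
        mem_words.2 ⟨hn.2.1, fun y hy => ?_, aU⟩, ?_⟩
      · have := h2 y (by simp [hy]); have := hL y hy; lia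
      · have := h2 y (by simp [hy]); have := hU y hy; lia
      · rw [Nat.add_sub_cancel' hxm.1]
    · rintro ⟨i, hi, L, hL, U, hU, e⟩
      obtain ⟨nL, bL, aL⟩ := mem_words.1 hL
      obtain ⟨nU, bU, aU⟩ := mem_words.1 hU
      rw [e]
      have cL : ∀ y ∈ L, y < a + i := fun y hy => (bL y hy).2
      have cU : ∀ y ∈ U, a + i < y := fun y hy => by have := bU y hy; lia
      have hx : a + i ∉ L ++ U := by
        intro h
        rcases List.mem_append.1 h with h | h
        · exact lt_irrefl _ (cL _ h)
        · exact lt_irrefl _ (cU _ h)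
      refine mem_words.2 ⟨?_, fun y hy => ?_, ?_⟩
      · refine List.nodup_append.2 ⟨List.nodup_append.2 ⟨nL, nU, fun y hy z hz => ?_⟩, by simp,
          fun y hy z hz => ?_⟩
        · exact ((cL y hy).trans (cU z hz)).ne
        · rw [List.mem_singleton.1 hz]
          exact fun e => hx (e ▸ hy)
      · simp only [List.mem_append, List.mem_singleton] at hy
        rcases hy with (hy | hy) | rfl
        · have := bL y hy; lia
        · have := bU y hy; lia
        · lia
      · exact (avoids_append_singleton_iff hx).2 ⟨L, U, rfl, cL, cU, aL, aU⟩

theorem lt_of_mem_words {a i : ℕ} {L : List ℕ} (h : L ∈ words a i) {y : ℕ} (hy : y ∈ L) :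
    y < a + i := ((mem_words.1 h).2.1 y hy).2

theorem gt_of_mem_words {a i m : ℕ} {U : List ℕ} (h : U ∈ words (a + i + 1) m) {y : ℕ}
    (hy : y ∈ U) : a + i < y := ((mem_words.1 h).2.1 y hy).1

theorem card_words (a m : ℕ) : (words a m).card =
    1 + ∑ i ∈ Finset.range m, (words a i).card * (words (a + i + 1) (m - 1 - i)).card := by
  rw [words_eq, Finset.card_insert_of_notMem, card_glue, add_comm]
  · exact fun i L hL y hy => lt_of_mem_words hL hy
  · exact fun i U hU y hy => gt_of_mem_words hU hy
  · rw [mem_glue]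
    rintro ⟨i, _, L, _, U, _, e⟩
    simp at e

/-- The number of `312`-avoiding words with distinct letters from an `m`-element alphabet. -/
noncomputable def numWords (m : ℕ) : ℕ := (words 0 m).card

/-- The recursion `card_words` has the same form for every `a`, so only the size of the alphabet
matters. -/
theorem card_words_eq (a m : ℕ) : (words a m).card = numWords m := by
  induction m using Nat.strong_induction_on generalizing a with
  | _ m ih =>
    rw [numWords, card_words, card_words 0]
    congr 1
    refine Finset.sum_congr rfl fun i hi => ?_
    have hi := Finset.mem_range.1 hi
    rw [ih i hi, ih i hi 0, ih _ (by lia), ih _ (by lia) (0 + i + 1)]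

theorem numWords_eq (m : ℕ) :
    numWords m = 1 + ∑ i ∈ Finset.range m, numWords i * numWords (m - 1 - i) := by
  rw [numWords, card_words]
  simp only [card_words_eq]

/-! ### Full words and redundant words -/

open Classical in
/-- The `312`-avoiding arrangements of the interval `[a, a + m)`. -/
noncomputable def fullWords (a m : ℕ) : Finset (List ℕ) :=
  (words a m).filter fun l => ∀ y, a ≤ y → y < a + m → y ∈ l

theorem mem_fullWords {a m : ℕ} {l : List ℕ} :
    l ∈ fullWords a m ↔ l ∈ words a m ∧ ∀ y, a ≤ y → y < a + m → y ∈ l := by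
  simp [fullWords]

theorem fullWords_succ (a m : ℕ) : fullWords a (m + 1) =
    glue a (m + 1) (fullWords a) fun i => fullWords (a + i + 1) (m - i) := by
  ext l
  rw [mem_fullWords, words_eq, Finset.mem_insert, mem_glue, mem_glue]
  constructor
  · rintro ⟨rfl | ⟨i, hi, L, hL, U, hU, rfl⟩, h⟩
    · exact absurd (h a le_rfl (by lia)) (by simp)
    · refine ⟨i, hi, L, mem_fullWords.2 ⟨hL, fun y h1 h2 => ?_⟩, U,
        mem_fullWords.2 ⟨hU, fun y h1 h2 => ?_⟩, rfl⟩
      · have := h y h1 (by lia)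
        simp only [List.mem_append, List.mem_singleton] at this
        rcases this with (h | h) | h
        · exact h
        · have := gt_of_mem_words hU h; lia
        · lia
      · have := h y (by lia) (by lia)
        simp only [List.mem_append, List.mem_singleton] at this
        rcases this with (h | h) | h
        · have := lt_of_mem_words hL h; lia
        · exact h
        · lia
  · rintro ⟨i, hi, L, hL, U, hU, rfl⟩
    obtain ⟨hL, fL⟩ := mem_fullWords.1 hL
    obtain ⟨hU, fU⟩ := mem_fullWords.1 hU
    refine ⟨Or.inr ⟨i, hi, L, hL, U, hU, rfl⟩, fun y h1 h2 => ?_⟩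
    simp only [List.mem_append, List.mem_singleton]
    rcases lt_trichotomy y (a + i) with h | h | h
    · exact Or.inl (Or.inl (fL y h1 h))
    · exact Or.inr h
    · exact Or.inl (Or.inr (fU y h (by lia)))

/-- Splitting at the last letter gives the Catalan recursion. -/
theorem card_fullWords (a m : ℕ) : (fullWords a m).card = catalan m := by
  induction m using Nat.strong_induction_on generalizing a with
  | _ m ih =>
    cases m with
    | zero =>
      rw [catalan_zero, Finset.card_eq_one]
      refine ⟨[], ?_⟩
      ext l
      rw [mem_fullWords, mem_words, Finset.mem_singleton]
      constructor
      · rintro ⟨⟨_, h, _⟩, _⟩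
        exact List.eq_nil_iff_forall_not_mem.2 fun y hy => by have := h y hy; lia
      · rintro rfl
        simp only [List.nodup_nil, Avoids, List.not_mem_nil, false_imp_iff, implies_true, and_true,
          true_and]
        intro y h1 h2; lia
    | succ m =>
      rw [fullWords_succ, card_glue, catalan_succ, ← Fin.sum_univ_eq_sum_range
        (fun i => (fullWords a i).card * (fullWords (a + i + 1) (m - i)).card)]
      · exact Finset.sum_congr rfl fun i _ => by rw [ih i i.2, ih _ (by lia)]
      · exact fun i L hL y hy => lt_of_mem_words (mem_fullWords.1 hL).1 hy
      · exact fun i U hU y hy => gt_of_mem_words (mem_fullWords.1 hU).1 hy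

/-- The words whose last letter may be moved across the dividing line: every smaller letter
occurs. -/
noncomputable def redundantWords (n : ℕ) : Finset (List ℕ) :=
  glue 0 n (fullWords 0) fun i => words (0 + i + 1) (n - 1 - i)

/-- In `L U x` the letters below `x` can occur only in `L`, so all of them occur exactly when `L` is
full. -/
theorem mem_redundantWords {n : ℕ} {l : List ℕ} {x : ℕ} :
    l ++ [x] ∈ redundantWords n ↔ l ++ [x] ∈ words 0 n ∧ ∀ y < x, y ∈ l := by
  rw [words_eq, Finset.mem_insert, redundantWords, mem_glue, mem_glue]
  simp only [List.append_eq_nil_iff, List.cons_ne_nil, and_false, false_or]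
  constructor
  · rintro ⟨i, hi, L, hL, U, hU, e⟩
    obtain ⟨hL, fL⟩ := mem_fullWords.1 hL
    refine ⟨⟨i, hi, L, hL, U, hU, e⟩, fun y hy => ?_⟩
    obtain ⟨rfl, e2⟩ := List.append_inj' e rfl
    rw [List.singleton_inj] at e2
    exact List.mem_append_left _ (fL y (by lia) (by lia))
  · rintro ⟨⟨i, hi, L, hL, U, hU, e⟩, h⟩
    refine ⟨i, hi, L, mem_fullWords.2 ⟨hL, fun y _ hy => ?_⟩, U, hU, e⟩
    obtain ⟨rfl, e2⟩ := List.append_inj' e rfl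
    rw [List.singleton_inj] at e2
    rcases List.mem_append.1 (h y (by lia)) with h | h
    · exact h
    · have := gt_of_mem_words hU h; lia

theorem redundantWords_subset (n : ℕ) : redundantWords n ⊆ words 0 n := by
  intro l h
  rcases List.eq_nil_or_concat' l with rfl | ⟨l, x, rfl⟩
  · simp [mem_words, Avoids]
  · exact (mem_redundantWords.1 h).1

theorem card_redundantWords (n : ℕ) : (redundantWords n).card =
    ∑ i ∈ Finset.range n, catalan i * numWords (n - 1 - i) := by
  rw [redundantWords, card_glue]
  · simp only [card_fullWords, card_words_eq]
  · exact fun i L hL y hy => lt_of_mem_words (mem_fullWords.1 hL).1 hy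
  · exact fun i U hU y hy => gt_of_mem_words hU hy

/-! ### From permutations to words -/

theorem exists_isPatternOf {k n : ℕ} {w : Fin k → Fin n} (hw : Function.Injective w) :
    ∃ α : Equiv.Perm (Fin k), IsPatternOf α w := by
  have hs : StrictMono (w ∘ Tuple.sort w) :=
    (Tuple.monotone_sort w).strictMono_of_injective (hw.comp (Tuple.sort w).injective)
  refine ⟨(Tuple.sort w).symm, fun i j => ?_⟩
  rw [← hs.lt_iff_lt]
  simp

/-- Avoidance by the standardization of `w` is avoidance by `w` itself, which removes the auxiliary
permutations from the definition of juxtaposition. -/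
theorem exists_mem_Av_iff {k n j : ℕ} {w : Fin k → Fin n} (hw : Function.Injective w)
    (π : Equiv.Perm (Fin j)) :
    (∃ α ∈ Av π k, IsPatternOf α w) ↔ ¬∃ f : Fin j ↪o Fin k, IsPatternOf π (w ∘ f) := by
  have key : ∀ α, IsPatternOf α w →
      (Contains α π ↔ ∃ f : Fin j ↪o Fin k, IsPatternOf π (w ∘ f)) := fun α h =>
    exists_congr fun f => forall₂_congr fun a b => by rw [Function.comp, Function.comp, h]
  constructor
  · rintro ⟨α, hα, h⟩
    rwa [← key α h]
  · intro h
    obtain ⟨α, hα⟩ := exists_isPatternOf hw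
    exact ⟨α, by rwa [← key α hα] at h, hα⟩

theorem exists_isPatternOf_p312_iff {k n : ℕ} {w : Fin k → Fin n} :
    (∃ f : Fin 3 ↪o Fin k, IsPatternOf p312 (w ∘ f)) ↔
      ∃ a b c, a < b ∧ b < c ∧ w b < w c ∧ w c < w a := by
  constructor
  · rintro ⟨f, hf⟩
    exact ⟨f 0, f 1, f 2, f.strictMono (by decide), f.strictMono (by decide),
      (hf 1 2).2 (by decide), (hf 2 0).2 (by decide)⟩
  · rintro ⟨a, b, c, hab, hbc, h1, h2⟩
    have hm : StrictMono ![a, b, c] := by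
      intro i j hij
      fin_cases i <;> fin_cases j <;> simp_all [hab.trans hbc]
    obtain ⟨f, f0, f1, f2⟩ : ∃ f : Fin 3 ↪o Fin k, f 0 = a ∧ f 1 = b ∧ f 2 = c :=
      ⟨OrderEmbedding.ofStrictMono _ hm, rfl, rfl, rfl⟩
    refine ⟨f, fun i j => ?_⟩
    have h3 := h1.trans h2
    fin_cases i <;> fin_cases j <;>
      simp [p312, f0, f1, f2, h1, h2, h3, h1.le, h2.le, h3.le]

theorem exists_isPatternOf_p21_iff {k n : ℕ} {w : Fin k → Fin n} :
    (∃ f : Fin 2 ↪o Fin k, IsPatternOf p21 (w ∘ f)) ↔ ∃ a b, a < b ∧ w b < w a := by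
  constructor
  · rintro ⟨f, hf⟩
    exact ⟨f 0, f 1, f.strictMono (by decide), (hf 1 0).2 (by decide)⟩
  · rintro ⟨a, b, hab, h1⟩
    have hm : StrictMono ![a, b] := by
      intro i j hij
      fin_cases i <;> fin_cases j <;> simp_all
    obtain ⟨f, f0, f1⟩ : ∃ f : Fin 2 ↪o Fin k, f 0 = a ∧ f 1 = b :=
      ⟨OrderEmbedding.ofStrictMono _ hm, rfl, rfl⟩
    refine ⟨f, fun i j => ?_⟩
    fin_cases i <;> fin_cases j <;> simp [p21, f0, f1, h1, h1.le]

theorem avoids_ofFn {k : ℕ} {w : Fin k → ℕ} :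
    Avoids (List.ofFn w) ↔ ¬∃ a b c, a < b ∧ b < c ∧ w b < w c ∧ w c < w a := by
  induction k with
  | zero => simp [Avoids]
  | succ k ih =>
    rw [List.ofFn_succ, Avoids, ih, List.pairwise_ofFn]
    simp only [not_exists, Fin.forall_fin_succ, Fin.succ_lt_succ_iff, Fin.not_lt_zero, false_and,
      not_false_eq_true, implies_true, and_true, Fin.succ_pos, true_and]
    grind

/-- The one-line notation of a permutation. -/
def oneLine {n : ℕ} (σ : Equiv.Perm (Fin n)) : List ℕ :=
  List.ofFn fun i => (σ i : ℕ)

theorem oneLine_injective {n : ℕ} :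
    Function.Injective (oneLine : Equiv.Perm (Fin n) → List ℕ) := by
  intro σ τ h
  ext i
  exact congrFun (List.ofFn_injective h) i

theorem mem_classC_iff {n : ℕ} {σ : Equiv.Perm (Fin n)} :
    σ ∈ classC n ↔ ∃ A B, oneLine σ = A ++ B ∧ Avoids A ∧ B.Pairwise (· < ·) := by
  have key : ∀ (k l : ℕ) (h : k + l = n),
      oneLine σ = List.ofFn (fun i => (σ (Fin.cast h (Fin.castAdd l i)) : ℕ)) ++
        List.ofFn (fun i => (σ (Fin.cast h (Fin.natAdd k i)) : ℕ)) ∧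
      ((∃ α ∈ Av p312 k, IsPatternOf α (fun i => σ (Fin.cast h (Fin.castAdd l i)))) ↔
        Avoids (List.ofFn (fun i => (σ (Fin.cast h (Fin.castAdd l i)) : ℕ)))) ∧
      ((∃ β ∈ Av p21 l, IsPatternOf β (fun i => σ (Fin.cast h (Fin.natAdd k i)))) ↔
        (List.ofFn (fun i => (σ (Fin.cast h (Fin.natAdd k i)) : ℕ))).Pairwise (· < ·)) := by
    rintro k l rfl
    have h1 : Function.Injective fun i => σ (Fin.cast rfl (Fin.castAdd l i)) := fun i j h => by
      simpa using h
    have h2 : Function.Injective fun i => σ (Fin.cast rfl (Fin.natAdd k i)) := fun i j h => by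
      simpa using h
    refine ⟨?_, ?_, ?_⟩
    · rw [oneLine, List.ofFn_add]
      rfl
    · rw [exists_mem_Av_iff h1, exists_isPatternOf_p312_iff, avoids_ofFn]
      rfl
    · rw [exists_mem_Av_iff h2, exists_isPatternOf_p21_iff, List.pairwise_ofFn]
      push Not
      refine forall₂_congr fun i j => forall_congr' fun hij => ?_
      rw [← Fin.lt_def, lt_iff_le_and_ne, iff_self_and]
      exact fun _ e => hij.ne (h2 e)
  constructor
  · rintro ⟨k, l, h, hA, hB⟩
    obtain ⟨h1, h2, h3⟩ := key k l h
    exact ⟨_, _, h1, h2.1 hA, h3.1 hB⟩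
  · rintro ⟨A, B, e, hA, hB⟩
    have hl : A.length + B.length = n := by
      rw [← List.length_append, ← e, oneLine, List.length_ofFn]
    obtain ⟨h1, h2, h3⟩ := key _ _ hl
    obtain ⟨rA, rB⟩ := List.append_inj (e.symm.trans h1) (by rw [List.length_ofFn])
    exact ⟨_, _, hl, h2.2 (rA ▸ hA), h3.2 (rB ▸ hB)⟩

theorem exists_oneLine_eq {n : ℕ} {l : List ℕ} (h : l.Perm (List.range n)) :
    ∃ σ : Equiv.Perm (Fin n), oneLine σ = l := by
  have hl : l.length = n := by rw [h.length_eq, List.length_range]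
  have hn : l.Nodup := h.nodup_iff.2 List.nodup_range
  have hb : ∀ i : Fin n, l.get (Fin.cast hl.symm i) < n := fun i =>
    List.mem_range.1 (h.mem_iff.1 (List.get_mem _ _))
  let f : Fin n → Fin n := fun i => ⟨l.get (Fin.cast hl.symm i), hb i⟩
  have hf : Function.Injective f := fun i j e => by
    have := (List.nodup_iff_injective_get.1 hn) (Fin.mk.inj_iff.1 e)
    simpa using this
  refine ⟨Equiv.ofBijective f (Finite.injective_iff_bijective.1 hf), ?_⟩
  refine List.ext_getElem (by simp [oneLine, hl]) fun i h1 h2 => ?_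
  simp [oneLine, f]

theorem oneLine_perm_range {n : ℕ} (σ : Equiv.Perm (Fin n)) :
    (oneLine σ).Perm (List.range n) := by
  refine (List.perm_ext_iff_of_nodup ?_ List.nodup_range).2 fun y => ?_
  · exact List.nodup_ofFn.2 fun i j e => σ.injective (Fin.ext e)
  · rw [oneLine, List.mem_ofFn, List.mem_range]
    constructor
    · rintro ⟨i, rfl⟩
      exact (σ i).2
    · exact fun hy => ⟨σ.symm ⟨y, hy⟩, by simp⟩

/-! ### Unique choice of the dividing line -/

/-- The letters below `n` that are missing from `l`, in increasing order. -/
def missing (n : ℕ) (l : List ℕ) : List ℕ :=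
  (List.range n).filter (· ∉ l)

theorem mem_missing {n : ℕ} {l : List ℕ} {y : ℕ} : y ∈ missing n l ↔ y < n ∧ y ∉ l := by
  simp [missing]

theorem missing_pairwise (n : ℕ) (l : List ℕ) : (missing n l).Pairwise (· < ·) :=
  List.pairwise_lt_range.filter _

theorem append_missing_perm {n : ℕ} {l : List ℕ} (h : l ∈ words 0 n) :
    (l ++ missing n l).Perm (List.range n) := by
  obtain ⟨h1, h2, _⟩ := mem_words.1 h
  refine (List.perm_ext_iff_of_nodup ?_ List.nodup_range).2 fun y => ?_
  · refine List.nodup_append.2 ⟨h1, (missing_pairwise n l).imp fun h => h.ne, ?_⟩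
    rintro y hy z hz rfl
    exact (mem_missing.1 hz).2 hy
  · have := h2 y
    rw [List.mem_append, mem_missing, List.mem_range]
    by_cases hy : y ∈ l <;> grind

theorem eq_missing_of_perm {n : ℕ} {A B : List ℕ} (h : (A ++ B).Perm (List.range n))
    (hB : B.Pairwise (· < ·)) : B = missing n A := by
  have hn : (A ++ B).Nodup := h.nodup_iff.2 List.nodup_range
  have hp : B.Perm (missing n A) := by
    refine (List.perm_ext_iff_of_nodup (List.nodup_append.1 hn).2.1
      ((missing_pairwise n A).imp fun h => h.ne)).2 fun y => ?_
    have h1 : y ∈ A ++ B ↔ y ∈ List.range n := h.mem_iff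
    rw [List.mem_append, List.mem_range] at h1
    rw [mem_missing, ← h1]
    have := (List.nodup_append.1 hn).2.2 y
    by_cases hy : y ∈ A <;> grind
  -- Two increasing arrangements of the same letters coincide.
  exact hp.eq_of_pairwise (fun a b _ _ h1 h2 => absurd h1 h2.not_gt) hB (missing_pairwise n A)

/-- If two words give the same permutation, one is a prefix of the other. The last letter of a
strictly longer one lies in the increasing part of the shorter cut, hence below all letters still
missing, so the longer word is redundant. -/
theorem append_missing_injOn (n : ℕ) :
    Set.InjOn (fun l => l ++ missing n l) (words 0 n \ redundantWords n : Finset (List ℕ)) := by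
  have key : ∀ l ∈ words 0 n, ∀ l' ∈ words 0 n, l' ∉ redundantWords n →
      l ++ missing n l = l' ++ missing n l' → l'.length ≤ l.length := by
    intro l _ l' hl' hr e
    by_contra! hlt
    obtain ⟨t, rfl, ht⟩ : ∃ t, l' = l ++ t ∧ missing n l = t ++ missing n l' := by
      rcases List.append_eq_append_iff.1 e with ⟨t, h1, h2⟩ | ⟨t, h1, h2⟩
      · exact ⟨t, h1, h2⟩
      · rw [h1, List.length_append] at hlt
        lia
    rcases List.eq_nil_or_concat' t with rfl | ⟨t, x, rfl⟩
    · simp at hlt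
    · rw [← List.append_assoc] at hr hl' ht
      refine hr (mem_redundantWords.2 ⟨hl', fun y hy => ?_⟩)
      have hp := missing_pairwise n l
      rw [ht] at hp
      have hx := ((mem_words.1 hl').2.1 x (by simp)).2
      by_contra hy'
      have hym : y ∈ missing n (l ++ t ++ [x]) :=
        mem_missing.2 ⟨by lia, by
          rw [List.mem_append, List.mem_singleton]
          rintro (h | h)
          · exact hy' h
          · lia⟩
      have := (List.pairwise_append.1 hp).2.2 x (by simp) y hym
      lia
  intro l hl l' hl' e
  simp only [Finset.coe_sdiff, Set.mem_sdiff, Finset.mem_coe] at hl hl'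
  exact List.append_inj_left e
    ((key l' hl'.1 l hl.1 hl.2 e.symm).antisymm (key l hl.1 l' hl'.1 hl'.2 e))

/-- The last letter of `A` is moved into `B` as long as `A` is redundant; the empty word is never
redundant. -/
theorem exists_minimal_prefix {n : ℕ} {A B : List ℕ} (h : (A ++ B).Perm (List.range n))
    (hA : Avoids A) (hB : B.Pairwise (· < ·)) :
    ∃ l ∈ words 0 n \ redundantWords n, l ++ missing n l = A ++ B := by
  induction A using List.reverseRecOn generalizing B with
  | nil =>
    refine ⟨[], ?_, by rw [← eq_missing_of_perm h hB]⟩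
    rw [Finset.mem_sdiff, redundantWords, mem_glue]
    refine ⟨mem_words.2 ⟨List.nodup_nil, by simp, trivial⟩, ?_⟩
    rintro ⟨i, _, L, _, U, _, e⟩
    simp at e
  | append_singleton A x ih =>
    have e := eq_missing_of_perm h hB
    by_cases hr : A ++ [x] ∈ redundantWords n
    · have h' : (A ++ x :: B).Perm (List.range n) := by simpa using h
      -- Redundancy puts every letter below `x` in `A`, so `x :: B` is still increasing.
      have hx : ∀ y ∈ B, x < y := fun y hy => by
        have hy' : y ∉ A ++ [x] := (mem_missing.1 (e ▸ hy)).2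
        rw [List.mem_append, List.mem_singleton, not_or] at hy'
        by_contra! hyx
        exact hy'.1 ((mem_redundantWords.1 hr).2 y (lt_of_le_of_ne hyx hy'.2))
      obtain ⟨l, hl, e'⟩ := ih h' hA.of_append_left (List.pairwise_cons.2 ⟨hx, hB⟩)
      exact ⟨l, hl, by rw [e']; simp⟩
    · refine ⟨A ++ [x], Finset.mem_sdiff.2 ⟨mem_words.2 ⟨?_, fun y hy => ?_, hA⟩, hr⟩, by rw [← e]⟩
      · exact (List.nodup_append.1 (h.nodup_iff.2 List.nodup_range)).1
      · have := List.mem_range.1 (h.mem_iff.1 (List.mem_append_left B hy))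
        lia

theorem ncard_classC (n : ℕ) :
    (classC n).ncard = (words 0 n \ redundantWords n).card := by
  have h : oneLine '' classC n =
      (fun l => l ++ missing n l) '' (words 0 n \ redundantWords n : Finset (List ℕ)) := by
    ext w
    constructor
    · rintro ⟨σ, hσ, rfl⟩
      obtain ⟨A, B, e, hA, hB⟩ := mem_classC_iff.1 hσ
      obtain ⟨l, hl, e'⟩ := exists_minimal_prefix (e ▸ oneLine_perm_range σ) hA hB
      exact ⟨l, hl, e'.trans e.symm⟩
    · rintro ⟨l, hl, rfl⟩
      have hl' := (Finset.mem_sdiff.1 hl).1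
      obtain ⟨σ, hσ⟩ := exists_oneLine_eq (append_missing_perm hl')
      exact ⟨σ, mem_classC_iff.2 ⟨l, missing n l, hσ, (mem_words.1 hl').2.2,
        missing_pairwise n l⟩, hσ⟩
  rw [← Set.ncard_image_of_injective _ oneLine_injective, h,
    (append_missing_injOn n).ncard_image, Set.ncard_coe_finset]

theorem ncard_classC_add (n : ℕ) : (classC n).ncard +
    ∑ i ∈ Finset.range n, catalan i * numWords (n - 1 - i) = numWords n := by
  rw [ncard_classC, ← card_redundantWords, Finset.card_sdiff_add_card_eq_card
    (redundantWords_subset n), numWords]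

/-! ### Generating functions and algebraicity -/

open PowerSeries

/-- The generating function of the Catalan numbers over `ℚ`. -/
noncomputable def catalanGF : PowerSeries ℚ := PowerSeries.mk fun n => (catalan n : ℚ)

/-- The generating function of `numWords`. -/
noncomputable def wordsGF : PowerSeries ℚ := PowerSeries.mk fun n => (numWords n : ℚ)

theorem catalanGF_eq : catalanGF = 1 + X * catalanGF ^ 2 := by
  have h := congrArg (PowerSeries.map (Nat.castRingHom ℚ)) catalanSeries_sq_mul_X_add_one
  have e : PowerSeries.map (Nat.castRingHom ℚ) catalanSeries = catalanGF := by
    ext n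
    simp [catalanGF]
  simp only [map_add, map_mul, map_pow, map_X, map_one, e] at h
  linear_combination -h

theorem coeff_X_mul_mk_mul_mk (f g : ℕ → ℚ) (n : ℕ) :
    coeff n (X * (PowerSeries.mk f * PowerSeries.mk g)) =
      ∑ i ∈ Finset.range n, f i * g (n - 1 - i) := by
  cases n with
  | zero => simp
  | succ n =>
    rw [coeff_succ_X_mul, coeff_mul]
    simp only [coeff_mk, Nat.add_sub_cancel]
    exact Finset.Nat.sum_antidiagonal_eq_sum_range_succ (fun i j => f i * g j) n

theorem one_sub_X_mul_wordsGF :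
    (1 - X) * wordsGF = 1 + (1 - X) * X * wordsGF ^ 2 := by
  -- The term `1/(1-X)` counts the empty word, once for each alphabet size.
  have h : wordsGF = PowerSeries.mk 1 + X * (wordsGF * wordsGF) := by
    ext n
    rw [map_add, wordsGF, coeff_X_mul_mk_mul_mk, coeff_mk, numWords_eq]
    simp
  have e : (PowerSeries.mk 1 : PowerSeries ℚ) * (1 - X) = 1 := mk_one_mul_one_sub_eq_one ℚ
  linear_combination (1 - X) * h + e

theorem genFun_classC_eq : genFun classC = wordsGF - X * (catalanGF * wordsGF) := by
  rw [eq_sub_iff_add_eq]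
  ext n
  rw [map_add, wordsGF, catalanGF, coeff_X_mul_mk_mul_mk, genFun, coeff_mk, coeff_mk,
    ← ncard_classC_add n]
  push_cast
  rfl

theorem algebraMap_polynomial_apply (p : Polynomial ℚ) :
    algebraMap (Polynomial ℚ) (PowerSeries ℚ) p = p := by
  rw [PowerSeries.algebraMap_apply', Algebra.algebraMap_self, PowerSeries.map_id, id]

theorem isAlgebraic_of_quadratic {s : PowerSeries ℚ} {a b c : Polynomial ℚ} (ha : a ≠ 0)
    (h : (a : PowerSeries ℚ) * s ^ 2 + b * s + c = 0) : IsAlgebraic (Polynomial ℚ) s := by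
  refine ⟨Polynomial.C a * Polynomial.X ^ 2 + Polynomial.C b * Polynomial.X + Polynomial.C c,
    fun h0 => ha ?_, ?_⟩
  · simpa [Polynomial.coeff_X, Polynomial.coeff_C] using
      congrArg (fun p => Polynomial.coeff p 2) h0
  · simpa [Polynomial.aeval_def, algebraMap_polynomial_apply] using h

theorem isAlgebraic_genFun_classC : IsAlgebraic (Polynomial ℚ) (genFun classC) := by
  have hC : IsAlgebraic (Polynomial ℚ) catalanGF := by
    refine isAlgebraic_of_quadratic (a := Polynomial.X) (b := -1) (c := 1) Polynomial.X_ne_zero ?_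
    push_cast
    linear_combination -catalanGF_eq
  have hW : IsAlgebraic (Polynomial ℚ) wordsGF := by
    refine isAlgebraic_of_quadratic (a := (1 - Polynomial.X) * Polynomial.X)
      (b := -(1 - Polynomial.X)) (c := 1) (mul_ne_zero (fun h => ?_) Polynomial.X_ne_zero) ?_
    · simpa using congrArg (Polynomial.eval 0) h
    · push_cast
      linear_combination -one_sub_X_mul_wordsGF
  have hX : IsAlgebraic (Polynomial ℚ) (X : PowerSeries ℚ) := by
    have := isAlgebraic_algebraMap (R := Polynomial ℚ) (A := PowerSeries ℚ) Polynomial.X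
    rwa [algebraMap_polynomial_apply, Polynomial.coe_X] at this
  rw [genFun_classC_eq]
  exact hW.sub (hX.mul (hC.mul hW))

theorem exists_sqrt_genFun_classC : ∃ u v : PowerSeries ℚ,
    (u ^ 2 = 1 - 4 * X ∧ constantCoeff u = 1) ∧
    (v ^ 2 = (X - 1) * (5 * X - 1) ∧ constantCoeff v = 1) ∧
    4 * X * (1 - X) * genFun classC = (1 + u) * (1 - X - v) := by
  -- These are the square roots of the discriminants: `u` from `X C^2 - C + 1 = 0`, and `v` from the
  -- equation for `W` multiplied by `1 - X`. Then `1 + u = 2(1 - X C)` and `1 - X - v = 2X(1 - X)W`.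
  refine ⟨1 - 2 * X * catalanGF, 1 - X - 2 * X * (1 - X) * wordsGF,
    ⟨?_, by simp⟩, ⟨?_, by simp⟩, ?_⟩
  · linear_combination -4 * X * catalanGF_eq
  · linear_combination -4 * X * (1 - X) * one_sub_X_mul_wordsGF
  · rw [genFun_classC_eq]
    ring

/-! ### Initial values -/

theorem numWords_values : (List.range 13).map numWords =
    [1, 2, 5, 15, 51, 188, 731, 2950, 12235, 51822, 223191, 974427, 4302645] := by
  have h0 : numWords 0 = 1 := by rw [numWords_eq]; simp
  have h1 : numWords 1 = 2 := by rw [numWords_eq]; simp [h0]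
  have h2 : numWords 2 = 5 := by rw [numWords_eq]; simp [Finset.sum_range_succ, h0, h1]
  have h3 : numWords 3 = 15 := by rw [numWords_eq]; simp [Finset.sum_range_succ, h0, h1, h2]
  have h4 : numWords 4 = 51 := by rw [numWords_eq]; simp [Finset.sum_range_succ, h0, h1, h2, h3]
  have h5 : numWords 5 = 188 := by
    rw [numWords_eq]; simp [Finset.sum_range_succ, h0, h1, h2, h3, h4]
  have h6 : numWords 6 = 731 := by
    rw [numWords_eq]; simp [Finset.sum_range_succ, h0, h1, h2, h3, h4, h5]
  have h7 : numWords 7 = 2950 := by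
    rw [numWords_eq]; simp [Finset.sum_range_succ, h0, h1, h2, h3, h4, h5, h6]
  have h8 : numWords 8 = 12235 := by
    rw [numWords_eq]; simp [Finset.sum_range_succ, h0, h1, h2, h3, h4, h5, h6, h7]
  have h9 : numWords 9 = 51822 := by
    rw [numWords_eq]; simp [Finset.sum_range_succ, h0, h1, h2, h3, h4, h5, h6, h7, h8]
  have h10 : numWords 10 = 223191 := by
    rw [numWords_eq]; simp [Finset.sum_range_succ, h0, h1, h2, h3, h4, h5, h6, h7, h8, h9]
  have h11 : numWords 11 = 974427 := by
    rw [numWords_eq]; simp [Finset.sum_range_succ, h0, h1, h2, h3, h4, h5, h6, h7, h8, h9, h10]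
  have h12 : numWords 12 = 4302645 := by
    rw [numWords_eq]
    simp [Finset.sum_range_succ, h0, h1, h2, h3, h4, h5, h6, h7, h8, h9, h10, h11]
  simp [List.range_succ, h0, h1, h2, h3, h4, h5, h6, h7, h8, h9, h10, h11, h12]

theorem catalan_values : (List.range 12).map catalan =
    [1, 1, 2, 5, 14, 42, 132, 429, 1430, 4862, 16796, 58786] := by
  -- The closed form lets `decide` evaluate the list.
  rw [funext catalan_eq_centralBinom_div]
  decide

theorem ncard_classC_values : (List.range 13).map (fun n => (classC n).ncard) =
    [1, 1, 2, 6, 22, 88, 367, 1568, 6810, 29943, 132958, 595227, 2683373] := by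
  have hw := numWords_values
  have hc := catalan_values
  have hs : ∀ n, (classC n).ncard =
      numWords n - ∑ i ∈ Finset.range n, catalan i * numWords (n - 1 - i) := fun n =>
    Nat.eq_sub_of_add_eq (ncard_classC_add n)
  simp only [List.range_succ, List.range_zero, List.nil_append, List.cons_append, List.map_cons,
    List.map_nil, List.cons.injEq, and_true] at hw hc
  obtain ⟨w0, w1, w2, w3, w4, w5, w6, w7, w8, w9, w10, w11, w12⟩ := hw
  obtain ⟨c0, c1, c2, c3, c4, c5, c6, c7, c8, c9, c10, c11⟩ := hc
  simp [List.range_succ, hs, Finset.sum_range_succ, w0, w1, w2, w3, w4, w5, w6, w7, w8, w9, w10,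
    w11, w12, c2, c3, c4, c5, c6, c7, c8, c9, c10, c11]

end Juxtaposition

theorem mainTheorem2 :
    (∃ u v : PowerSeries ℚ,
      (u ^ 2 = 1 - 4 * PowerSeries.X ∧ PowerSeries.constantCoeff u = 1) ∧
      (v ^ 2 = (PowerSeries.X - 1) * (5 * PowerSeries.X - 1) ∧
        PowerSeries.constantCoeff v = 1) ∧
      4 * PowerSeries.X * (1 - PowerSeries.X) * Juxtaposition.genFun Juxtaposition.classC =
        (1 + u) * (1 - PowerSeries.X - v)) ∧
    IsAlgebraic (Polynomial ℚ) (Juxtaposition.genFun Juxtaposition.classC) ∧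
    (List.range 13).map (fun n => (Juxtaposition.classC n).ncard) =
      [1, 1, 2, 6, 22, 88, 367, 1568, 6810, 29943, 132958, 595227, 2683373] :=
  ⟨Juxtaposition.exists_sqrt_genFun_classC, Juxtaposition.isAlgebraic_genFun_classC,
    Juxtaposition.ncard_classC_values⟩
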